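/- Let $N\ge 1$ and let $\alpha,\beta,\gamma,\eta,\rho\in\mathbb C$ with $\beta\ne0$, $\gamma\ne0$, $\gamma\neq1$. Put $a=\alpha+\frac{\eta\rho}{1-\gamma}$, $b=\frac{\beta\rho}{1-\gamma}$ and assume $a\neq0$. For $x,y\in\mathbb C^N$ let $$\hat g_n(x,y)=a^{1-N}(\eta y_n+\beta)\prod_{j=1}^N\frac{y_n-ax_j-b}{\eta x_j+\beta}\prod_{j\ne n}\frac{\eta y_j+a\beta-b\eta}{y_n-y_j},\qquad n=1,\dots,N.$$ Call the pair $(x,y)$ regular if the $x_n$ are pairwise distinct, the $y_n$ are pairwise distinct, and $\eta x_n+\beta\ne0$, $\hat g_n(x,y)\neq0$ for all $n$. The discrete-time dynamical system under consideration (the "fourth model") is the following: $z_1(\ell+2),\dots,z_N(\ell+2)$ are the $N$ roots (with multiplicity, in any order) of the equation $$\sum_{k=1}^N\frac{\hat g_k(z(\ell),z(\ell+1))}{\zeta-az_k(\ell+1)-b}=\frac1\gamma$$ in the unknown $\zeta$, that is, of the monic polynomial of degree $N$ obtained by multiplying it by $\gamma\prod_j(\zeta-az_j(\ell+1)-b)$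 and collecting terms. Let $Z(\ell)=\mathrm{diag}[z_n(\ell)]$, $M_{nm}(0)=\dfrac{\hat g_m(z(0),z(1))}{z_m(1)-az_n(0)-b}$, and $$U(0)=Z(0),\qquad V(0)=[\eta Z(0)+\beta]^{-1}\{M(0)Z(1)M(0)^{-1}-\alpha Z(0)\},\qquad A=\eta V(0)-\tfrac{\eta}{\beta}b,\qquad B=\beta V(0)-b,$$ $$P(\ell_1,\ell_2)=\prod_{j=\ell_1}^{\ell_2}(A\gamma^j+a),\qquad U(\ell)=U(0)P(0,\ell-1)+\sum_{k=1}^{\ell}(B\gamma^{k-1}+b)P(k,\ell-1),$$ with the empty product equal to $I$ and the empty sum equal to $0$. Let $L\ge0$ be an integer and let $z(\ell)\in\mathbb C^N$, $\ell=0,1,2,\dots$, be such that $(z(0),z(1))$ is regular and $(z(\ell),z(\ell+1))$ is regular whenever $\ell+2\le L$. Then: 1. The equations of motion hold for all $\ell\geq 0$ with $\ell+2\le L$ if and only if, for every $0\le\ell\le L$, the coordinates $z_1(\ell),\dots,z_N(\ell)$ are the $N$ eigenvalues of $U(\ell)$, counted with algebraic multiplicity. 2. The solution of the matrix system $U(\ell+1)=\alpha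 U(\ell)+\beta V(\ell)+\eta U(\ell)V(\ell)$, $V(\ell+1)=\rho I+\gamma V(\ell)$ with the initial values $U(0)$, $V(0)$ above is given by the matrix $U(\ell)$ above and $V(\ell)=\gamma^\ell V(0)+\rho\frac{\gamma^\ell-1}{\gamma-1}I$, for all $\ell\ge0$. 3. The vector $g=\hat g(z(0),z(1))$ is the unique solution of the linear system $$\sum_{k=1}^N\frac{g_k}{(\eta z_k(1)+\beta)(z_k(1)-az_n(0)-b)}=\frac1{\eta z_n(0)+\beta},\qquad n=1,\dots,N.$$ 4. The matrix $M(0)$ is invertible, with $$[M(0)^{-1}]_{nm}=a^{1-N}\,\frac{z_n(1)-az_m(0)-b}{\hat g_n(z(0),z(1))}\prod_{j\ne n}\frac{z_j(1)-az_m(0)-b}{z_j(1)-z_n(1)}\prod_{j\neq m}\frac{z_n(1)-az_j(0)-b}{z_m(0)-z_j(0)},$$ and $$V_{nm}(0)=-\frac{\alpha z_n(0)}{\eta z_n(0)+\beta}\delta_{nm}+\frac{a^{1-N}}{\eta z_n(0)+\beta}\sum_{k=1}^N z_k(1)\left\{\prod_{j\ne k}\frac{z_j(1)-az_m(0)-b}{z_j(1)-z_k(1)}\right\}\frac{\prod_{j\neq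 n}[z_k(1)-az_j(0)-b]}{\prod_{j\ne m}[z_m(0)-z_j(0)]}.$$ -/

import Mathlib

noncomputable section

namespace DiscreteGoldfish

/-- The five coupling constants of the model. -/
structure Params where
  α : ℂ
  β : ℂ
  γ : ℂ
  η : ℂ
  ρ : ℂ

namespace Params

variable {N : ℕ} (p : Params)

/-- The derived constant `a = α + η ρ / (1 - γ)`. -/
def a : ℂ := p.α + p.η * p.ρ / (1 - p.γ)

/-- The derived constant `b = β ρ / (1 - γ)`. -/
def b : ℂ := p.β * p.ρ / (1 - p.γ)

/-- The quantities `ĝ_n(x, y)`, for the coordinates `x = z(ℓ)` and the once-updated coordinates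
`y = z(ℓ + 1)`. -/
def ghat (x y : Fin N → ℂ) (n : Fin N) : ℂ :=
  p.a ^ (1 - (N : ℤ)) * (p.η * y n + p.β)
    * (∏ j, (y n - p.a * x j - p.b) / (p.η * x j + p.β))
    * ∏ j ∈ Finset.univ.erase n, (p.η * y j + p.a * p.β - p.b * p.η) / (y n - y j)

/-- The equation of motion `∑ k, ĝ_k(x, y) / (ζ - a y_k - b) = 1 / γ` in the unknown `ζ`,
multiplied by `γ ∏ j, (ζ - a y_j - b)` and with all terms moved to one side:
a monic polynomial of degree `N` in `ζ`. -/
def motionPoly (x y : Fin N → ℂ) : Polynomial ℂ :=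
  (∏ j, (Polynomial.X - Polynomial.C (p.a * y j + p.b)))
    - Polynomial.C p.γ * ∑ k, Polynomial.C (p.ghat x y k)
        * ∏ j ∈ Finset.univ.erase k, (Polynomial.X - Polynomial.C (p.a * y j + p.b))

/-- The equations of motion: the twice-updated coordinates `w = z(ℓ + 2)` are the `N` roots,
counted with multiplicity and in any order, of the equation of motion determined by `x = z(ℓ)`
and `y = z(ℓ + 1)`. -/
def IsUpdate (x y w : Fin N → ℂ) : Prop :=
  (p.motionPoly x y).roots = (Finset.univ : Finset (Fin N)).val.map w

/-- Two consecutive configurations `x = z(ℓ)`, `y = z(ℓ + 1)` are in general position: the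
particles do not collide, and no denominator occurring in `ĝ(x, y)`, in `M` or in the inverse
of `M` vanishes (`ĝ_n(x, y) ≠ 0` includes `y_n - a x_m - b ≠ 0`). Given the other conditions,
`ĝ_n(x, y) ≠ 0` for all `n` says exactly that no root of the polynomial above is one of the
poles `a y_k + b` of the equation of motion. -/
structure Regular (x y : Fin N → ℂ) : Prop where
  inj_left : Function.Injective x
  inj_right : Function.Injective y
  denom_ne : ∀ n, p.η * x n + p.β ≠ 0
  ghat_ne : ∀ n, p.ghat x y n ≠ 0

/-- The matrix `M_{nm} = ĝ_m(x, y) / (y_m - a x_n - b)`. -/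
def M (x y : Fin N → ℂ) : Matrix (Fin N) (Fin N) ℂ :=
  Matrix.of fun n m => p.ghat x y m / (y m - p.a * x n - p.b)

/-- The matrix `V(0) = [η Z(0) + β]⁻¹ {M(0) Z(1) M(0)⁻¹ - α Z(0)}`, for `x = z(0)` and
`y = z(1)`. -/
def V0 (x y : Fin N → ℂ) : Matrix (Fin N) (Fin N) ℂ :=
  (p.η • Matrix.diagonal x + p.β • (1 : Matrix (Fin N) (Fin N) ℂ))⁻¹
    * (p.M x y * Matrix.diagonal y * (p.M x y)⁻¹ - p.α • Matrix.diagonal x)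

/-- The matrix `A = η V(0) - (η / β) b`. -/
def A (x y : Fin N → ℂ) : Matrix (Fin N) (Fin N) ℂ :=
  p.η • p.V0 x y - (p.η / p.β * p.b) • (1 : Matrix (Fin N) (Fin N) ℂ)

/-- The matrix `B = β V(0) - b`. -/
def B (x y : Fin N → ℂ) : Matrix (Fin N) (Fin N) ℂ :=
  p.β • p.V0 x y - p.b • (1 : Matrix (Fin N) (Fin N) ℂ)

/-- `P x y s t` is the product of `A γ ^ j + a` over `s ≤ j < t`, that is `P(s, t - 1)` in the
notation with two included end points; it is `1` if `t ≤ s`. -/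
def P (x y : Fin N → ℂ) (s t : ℕ) : Matrix (Fin N) (Fin N) ℂ :=
  ((List.range' s (t - s)).map fun j =>
    p.γ ^ j • p.A x y + p.a • (1 : Matrix (Fin N) (Fin N) ℂ)).prod

/-- The matrix
`U(ℓ) = U(0) P(0, ℓ - 1) + ∑_{k = 1}^ℓ (B γ ^ (k - 1) + b) P(k, ℓ - 1)`, `U(0) = diag x`,
for the initial data `x = z(0)`, `y = z(1)`. -/
def U (x y : Fin N → ℂ) (ℓ : ℕ) : Matrix (Fin N) (Fin N) ℂ :=
  Matrix.diagonal x * p.P x y 0 ℓ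
    + ∑ k ∈ Finset.Icc 1 ℓ,
        (p.γ ^ (k - 1) • p.B x y + p.b • (1 : Matrix (Fin N) (Fin N) ℂ)) * p.P x y k ℓ

/-- In general position the roots of `motionPoly` are exactly the solutions of the equation of
motion. -/
theorem eval_motionPoly_eq_zero_iff (hγ : p.γ ≠ 0) (ha : p.a ≠ 0) {x y : Fin N → ℂ}
    (h : p.Regular x y) (ζ : ℂ) :
    (p.motionPoly x y).eval ζ = 0 ↔
      (∀ k, ζ - p.a * y k - p.b ≠ 0) ∧
        ∑ k, p.ghat x y k / (ζ - p.a * y k - p.b) = 1 / p.γ := by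
  have hev : (p.motionPoly x y).eval ζ = (∏ j, (ζ - p.a * y j - p.b))
      - p.γ * ∑ k, p.ghat x y k * ∏ j ∈ Finset.univ.erase k, (ζ - p.a * y j - p.b) := by
    simp [motionPoly, Polynomial.eval_prod, Polynomial.eval_finsetSum, sub_sub]
  rw [hev]
  by_cases hz : ∀ k, ζ - p.a * y k - p.b ≠ 0
  · have hP : (∏ j, (ζ - p.a * y j - p.b)) ≠ 0 := Finset.prod_ne_zero_iff.mpr fun j _ => hz j
    have hs : ∑ k, p.ghat x y k * ∏ j ∈ Finset.univ.erase k, (ζ - p.a * y j - p.b)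
        = (∑ k, p.ghat x y k / (ζ - p.a * y k - p.b)) * ∏ j, (ζ - p.a * y j - p.b) := by
      rw [Finset.sum_mul]
      refine Finset.sum_congr rfl fun k _ => ?_
      rw [← Finset.mul_prod_erase Finset.univ _ (Finset.mem_univ k)]
      have := hz k
      field_simp
    rw [hs]
    set S := ∑ k, p.ghat x y k / (ζ - p.a * y k - p.b)
    constructor
    · intro h0
      refine ⟨hz, ?_⟩
      have h1 : (1 - p.γ * S) * ∏ j, (ζ - p.a * y j - p.b) = 0 := by linear_combination h0
      rcases mul_eq_zero.mp h1 with h2 | h2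
      · rw [eq_div_iff hγ]; linear_combination -h2
      · exact absurd h2 hP
    · rintro ⟨-, h0⟩
      rw [h0]; field_simp; ring
  · refine iff_of_false ?_ fun h0 => hz h0.1
    push Not at hz
    obtain ⟨k, hk⟩ := hz
    rw [Finset.prod_eq_zero (Finset.mem_univ k) hk, Finset.sum_eq_single k]
    · have h1 : ∏ j ∈ Finset.univ.erase k, (ζ - p.a * y j - p.b) ≠ 0 := by
        refine Finset.prod_ne_zero_iff.mpr fun j hj h2 => ?_
        have h3 : p.a * y j = p.a * y k := by linear_combination hk - h2
        exact (Finset.mem_erase.mp hj).1 (h.inj_right (mul_left_cancel₀ ha h3))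
      simp [hγ, h.ghat_ne k, h1]
    · intro j _ hj
      rw [Finset.prod_eq_zero (Finset.mem_erase.mpr ⟨hj.symm, Finset.mem_univ k⟩) hk, mul_zero]
    · simp

end Params

end DiscreteGoldfish

end

/-! Subtracting from `V0` the fixed point `ρ / (1 - γ) = b / β` of the `V`-recursion gives a
constant matrix `W` with `U(ℓ+1) = a U(ℓ) + b + γ^ℓ (η U(ℓ) + β) W` (`U_succ_eq`). Suppose `R`
diagonalizes `U(ℓ)` with spectrum `z`, and `R M(z,w)` diagonalizes `U(ℓ+1)` with spectrum `w`. Let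
every row of `G` be `ĝ(z,w)`. Then `M diag w - (a diag z + b) M = G`, while the linear system for
`ĝ` says `(η z + β) M (η w + β)⁻¹ G = G`. Comparing the two determines `W`, and in the basis `R M`
the matrix `U(ℓ+2)` becomes `diag (a w + b) + γ G` (`step_mul`). This is a rank-one perturbation of
a diagonal matrix, whose characteristic polynomial is `motionPoly` (`charpoly_diagonal_add_row`). If
`v` obeys the equations of motion, the columns of `M(w,v)` are its eigenvectors
(`stepMatrix_mul_M`), so the induction continues. The inverse of `M` and the linear system both come
from one interpolation identity, `sum_prod_sub_mul_prod_div`. -/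

/-! ### Lagrange interpolation and characteristic polynomials. -/

open Polynomial in
/-- Homogenized Lagrange interpolation of `∏ j ≠ n, (t - c j)` at the nodes `y`. -/
theorem sum_prod_sub_mul_prod_div {ι K : Type*} [Fintype ι] [DecidableEq ι] [Field K]
    {y : ι → K} (hy : Function.Injective y) (c : ι → K) (e s : K) (n : ι) :
    ∑ k, (∏ j ∈ Finset.univ.erase n, (y k - c j))
        * ∏ j ∈ Finset.univ.erase k, (e * y j + s) / (y k - y j)
      = ∏ j ∈ Finset.univ.erase n, (e * c j + s) := by
  classical
  set F : K[X] := Lagrange.nodal (Finset.univ.erase n) c with hF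
  have hFev : ∀ t, F.eval t = ∏ j ∈ Finset.univ.erase n, (t - c j) := fun t =>
    Lagrange.eval_nodal
  have hcard : ∀ k : ι, (Finset.univ.erase k).card = Fintype.card ι - 1 := fun k => by
    rw [Finset.card_erase_of_mem (Finset.mem_univ k), Finset.card_univ]
  have hpos : 0 < Fintype.card ι := Fintype.card_pos_iff.mpr ⟨n⟩
  have hnat : F.degree = ((Fintype.card ι - 1 : ℕ) : WithBot ℕ) := by
    rw [hF, Lagrange.degree_nodal, hcard]
  have hlt : F.degree < (Finset.univ : Finset ι).card := by
    rw [hnat, Finset.card_univ]; exact_mod_cast Nat.sub_lt hpos one_pos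
  -- For `e ≠ 0` interpolation is evaluated at `-s / e`; for `e = 0` that point goes to infinity and
  -- the leading coefficient takes its place.
  by_cases he : e = 0
  · subst he
    have h1 := Lagrange.leadingCoeff_eq_sum (s := Finset.univ) (v := y) (P := F) hy.injOn
      (by rw [hnat, Finset.card_univ]; exact_mod_cast (Nat.sub_add_cancel hpos).symm)
    rw [(Lagrange.nodal_monic (s := Finset.univ.erase n) (v := c)).leadingCoeff] at h1
    simp only [zero_mul, zero_add, Finset.prod_div_distrib, Finset.prod_const, hcard]
    simp only [hFev] at h1
    calc _ = s ^ (Fintype.card ι - 1) * ∑ k, (∏ j ∈ Finset.univ.erase n, (y k - c j))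
            / ∏ j ∈ Finset.univ.erase k, (y k - y j) := by
          rw [Finset.mul_sum]
          exact Finset.sum_congr rfl fun k _ => by ring
      _ = _ := by rw [← h1, mul_one]
  · have hlin : ∀ u, e * u + s = -e * (-s / e - u) := fun u => by field_simp; ring
    have h1 := congrArg (eval (-s / e)) (Lagrange.eq_interpolate (s := Finset.univ) hy.injOn hlt)
    simp only [Lagrange.interpolate_apply, eval_finsetSum, eval_mul, eval_C, hFev,
      Lagrange.basis, Lagrange.basisDivisor, eval_prod, eval_sub, eval_X] at h1
    simp only [hlin, mul_div_assoc, Finset.prod_mul_distrib, Finset.prod_const, hcard, h1,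
      Finset.mul_sum]
    refine Finset.sum_congr rfl fun k _ => ?_
    simp only [div_eq_inv_mul, Finset.prod_mul_distrib]
    ring

open Polynomial in
theorem charpoly_diagonal_add_row {ι K : Type*} [Fintype ι] [DecidableEq ι] [Field K] [Infinite K]
    (c g : ι → K) :
    (Matrix.diagonal c + Matrix.of fun _ m => g m).charpoly
      = (∏ j, (X - C (c j))) - ∑ k, C (g k) * ∏ j ∈ Finset.univ.erase k, (X - C (c j)) := by
  apply Polynomial.eq_of_infinite_eval_eq
  -- Off the finitely many `c k` the diagonal part is invertible, so the matrix determinant lemma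
  -- applies.
  refine ((Set.finite_range c).infinite_compl).mono fun t ht => ?_
  have ht' : ∀ k, t - c k ≠ 0 := fun k hk => ht ⟨k, (sub_eq_zero.mp hk).symm⟩
  have hD : Matrix.scalar ι t - (Matrix.diagonal c + Matrix.of fun _ m => g m)
      = Matrix.diagonal (fun k => t - c k)
        * (1 + Matrix.replicateCol Unit (fun k => (t - c k)⁻¹)
          * Matrix.replicateRow Unit (fun m => -g m)) := by
    ext i j
    have := ht' i
    rw [Matrix.diagonal_mul]
    simp only [Matrix.scalar_apply, Matrix.add_apply, Matrix.sub_apply,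
      Matrix.of_apply, Matrix.mul_apply, Matrix.replicateCol_apply, Matrix.replicateRow_apply,
      Finset.univ_unique, Finset.sum_singleton, Matrix.diagonal_apply, Matrix.one_apply]
    split_ifs <;> field_simp <;> ring
  change eval t _ = eval t _
  rw [Matrix.eval_charpoly, hD, Matrix.det_mul, Matrix.det_diagonal,
    Matrix.det_one_add_replicateCol_mul_replicateRow]
  simp only [eval_sub, eval_prod, eval_X, eval_C, eval_finsetSum, eval_mul, dotProduct]
  rw [mul_add, mul_one, Finset.mul_sum, sub_eq_add_neg (∏ j, (t - c j)), ← Finset.sum_neg_distrib]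
  congr 1
  refine Finset.sum_congr rfl fun k _ => ?_
  rw [← Finset.mul_prod_erase Finset.univ _ (Finset.mem_univ k)]
  have := ht' k
  field_simp

theorem charpoly_eq_of_mul_eq_mul {ι K : Type*} [Fintype ι] [DecidableEq ι] [CommRing K]
    {R S T : Matrix ι ι K} (hR : IsUnit R.det) (h : T * R = R * S) :
    T.charpoly = S.charpoly := by
  have : T = R * (S * R⁻¹) := by
    rw [← Matrix.mul_assoc, ← h, Matrix.mul_assoc, Matrix.mul_nonsing_inv _ hR, Matrix.mul_one]
  rw [this, Matrix.charpoly_mul_comm, Matrix.mul_assoc, Matrix.nonsing_inv_mul _ hR,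
    Matrix.mul_one]
-- The inverse of `M`, the linear system for `ĝ`, and the entries of `V0`.
namespace DiscreteGoldfish

namespace Params

variable {N : ℕ} (p : Params)

/-- The inverse of `M x y`. -/
noncomputable def MInv (x y : Fin N → ℂ) : Matrix (Fin N) (Fin N) ℂ :=
  Matrix.of fun n m => p.a ^ (1 - (N : ℤ)) * ((y n - p.a * x m - p.b) / p.ghat x y n)
        * (∏ j ∈ Finset.univ.erase n, (y j - p.a * x m - p.b) / (y j - y n))
        * ∏ j ∈ Finset.univ.erase m, (y n - p.a * x j - p.b) / (x m - x j)

variable {p} {x y : Fin N → ℂ}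

theorem card_erase_fin (n : Fin N) : (Finset.univ.erase n).card = N - 1 := by
  rw [Finset.card_erase_of_mem (Finset.mem_univ n), Finset.card_univ, Fintype.card_fin]

theorem zpow_one_sub_mul_pow {a : ℂ} (ha : a ≠ 0) (n : Fin N) :
    a ^ (1 - (N : ℤ)) * a ^ (N - 1) = 1 := by
  have hN : 1 ≤ N := by have := n.isLt; omega
  rw [← zpow_natCast, ← zpow_add₀ ha, Nat.cast_sub hN]
  simp

theorem prod_erase_neg_div_neg (f g : Fin N → ℂ) (k : Fin N) :
    ∏ j ∈ Finset.univ.erase k, f j / (g j - g k)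
      = ∏ j ∈ Finset.univ.erase k, -f j / (g k - g j) := by
  refine Finset.prod_congr rfl fun j _ => ?_
  rw [← neg_sub (g j) (g k), neg_div_neg_eq]

namespace Regular

theorem sub_ne (h : p.Regular x y) (m n : Fin N) : y m - p.a * x n - p.b ≠ 0 := by
  intro h0
  apply h.ghat_ne m
  rw [ghat, Finset.prod_eq_zero (Finset.mem_univ n) (by rw [h0, zero_div])]
  ring

theorem denom_right_ne (h : p.Regular x y) (n : Fin N) : p.η * y n + p.β ≠ 0 := by
  intro h0
  apply h.ghat_ne n
  rw [ghat, h0]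
  ring

theorem M_mul_MInv (ha : p.a ≠ 0) (h : p.Regular x y) : p.M x y * p.MInv x y = 1 := by
  ext n l
  have hx : ∏ j ∈ Finset.univ.erase l, (x l - x j) ≠ 0 := Finset.prod_ne_zero_iff.mpr
    fun j hj => sub_ne_zero.mpr fun e => (Finset.mem_erase.mp hj).1 (h.inj_left e).symm
  -- With these constants the right side is `∏ j ≠ n, a (x l - x j)`, which vanishes unless `n = l`.
  have key := sum_prod_sub_mul_prod_div h.inj_right (fun j => p.a * x j + p.b) (-1)
    (p.a * x l + p.b) n
  have hz := zpow_one_sub_mul_pow ha n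
  have hterm : ∀ k, p.M x y n k * p.MInv x y k l
      = p.a ^ (1 - (N : ℤ)) / (∏ j ∈ Finset.univ.erase l, (x l - x j))
        * ((∏ j ∈ Finset.univ.erase n, (y k - (p.a * x j + p.b)))
          * ∏ j ∈ Finset.univ.erase k, (-1 * y j + (p.a * x l + p.b)) / (y k - y j)) := by
    intro k
    have hg := h.ghat_ne k
    have hs := h.sub_ne k n
    have e1 : (y k - p.a * x l - p.b) * ∏ j ∈ Finset.univ.erase l, (y k - p.a * x j - p.b)
        = (y k - p.a * x n - p.b) * ∏ j ∈ Finset.univ.erase n, (y k - p.a * x j - p.b) := by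
      rw [Finset.mul_prod_erase Finset.univ (fun j => y k - p.a * x j - p.b) (Finset.mem_univ l),
        Finset.mul_prod_erase Finset.univ (fun j => y k - p.a * x j - p.b) (Finset.mem_univ n)]
    have e2 : ∏ j ∈ Finset.univ.erase k, (-1 * y j + (p.a * x l + p.b)) / (y k - y j)
        = ∏ j ∈ Finset.univ.erase k, (y j - p.a * x l - p.b) / (y j - y k) := by
      rw [prod_erase_neg_div_neg]
      exact Finset.prod_congr rfl fun j _ => by ring
    simp only [M, MInv, Matrix.of_apply, e2, ← sub_sub,
      Finset.prod_div_distrib (f := fun j => y k - p.a * x j - p.b)]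
    field_simp
    linear_combination (∏ j ∈ Finset.univ.erase k, (y j - p.a * x l - p.b) / (y j - y k)) * e1
  rw [Matrix.mul_apply, Finset.sum_congr rfl fun k _ => hterm k, ← Finset.mul_sum, key,
    Matrix.one_apply]
  split_ifs with hnl
  · subst hnl
    have : ∀ j, -1 * (p.a * x j + p.b) + (p.a * x n + p.b) = p.a * (x n - x j) := fun j => by ring
    simp only [this, Finset.prod_mul_distrib, Finset.prod_const, card_erase_fin]
    field_simp
    exact hz
  · rw [Finset.prod_eq_zero (Finset.mem_erase.mpr ⟨Ne.symm hnl, Finset.mem_univ l⟩) (by ring),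
      mul_zero]

theorem isUnit_det_M (ha : p.a ≠ 0) (h : p.Regular x y) : IsUnit (p.M x y).det :=
  Matrix.isUnit_det_of_right_inverse (h.M_mul_MInv ha)

theorem inv_M (ha : p.a ≠ 0) (h : p.Regular x y) : (p.M x y)⁻¹ = p.MInv x y :=
  Matrix.inv_eq_right_inv (h.M_mul_MInv ha)

theorem sum_ghat_div (ha : p.a ≠ 0) (h : p.Regular x y) (n : Fin N) :
    ∑ k, p.ghat x y k / ((p.η * y k + p.β) * (y k - p.a * x n - p.b))
      = 1 / (p.η * x n + p.β) := by
  -- These constants turn each factor on the right into `a (η x j + β)`.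
  have key := sum_prod_sub_mul_prod_div h.inj_right (fun j => p.a * x j + p.b) p.η
    (p.a * p.β - p.b * p.η) n
  have hz := zpow_one_sub_mul_pow ha n
  have hD : ∏ j, (p.η * x j + p.β) ≠ 0 := Finset.prod_ne_zero_iff.mpr fun j _ => h.denom_ne j
  have hterm : ∀ k, p.ghat x y k / ((p.η * y k + p.β) * (y k - p.a * x n - p.b))
      = p.a ^ (1 - (N : ℤ)) / (∏ j, (p.η * x j + p.β))
        * ((∏ j ∈ Finset.univ.erase n, (y k - (p.a * x j + p.b)))
          * ∏ j ∈ Finset.univ.erase k, (p.η * y j + (p.a * p.β - p.b * p.η)) / (y k - y j)) := by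
    intro k
    have hs := h.sub_ne k n
    have hd := h.denom_right_ne k
    simp only [ghat, ← sub_sub, ← add_sub_assoc, Finset.prod_div_distrib
      (f := fun j => y k - p.a * x j - p.b)]
    rw [← Finset.mul_prod_erase Finset.univ (fun j => y k - p.a * x j - p.b) (Finset.mem_univ n)]
    field_simp
  have : ∀ j, p.η * (p.a * x j + p.b) + (p.a * p.β - p.b * p.η) = p.a * (p.η * x j + p.β) :=
    fun j => by ring
  rw [Finset.sum_congr rfl fun k _ => hterm k, ← Finset.mul_sum, key]
  simp only [this, Finset.prod_mul_distrib, Finset.prod_const, card_erase_fin]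
  rw [← Finset.mul_prod_erase Finset.univ (fun j => p.η * x j + p.β) (Finset.mem_univ n)] at hD ⊢
  have h1 := h.denom_ne n
  have h2 := right_ne_zero_of_mul hD
  field_simp
  exact hz

theorem linear_system_iff (ha : p.a ≠ 0) (h : p.Regular x y) (g : Fin N → ℂ) :
    (∀ n, ∑ k, g k / ((p.η * y k + p.β) * (y k - p.a * x n - p.b)) = 1 / (p.η * x n + p.β)) ↔
      g = p.ghat x y := by
  refine ⟨fun hg => ?_, fun hg => hg ▸ h.sum_ghat_div ha⟩
  -- The coefficient matrix is `M` with rescaled columns; `v` is the difference of two solutions,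
  -- rescaled to lie in the kernel of `M`.
  set v : Fin N → ℂ := fun k =>
    (g k - p.ghat x y k) / ((p.η * y k + p.β) * p.ghat x y k) with hv
  have hMv : (p.M x y).mulVec v = 0 := by
    ext n
    have h1 := (hg n).trans (h.sum_ghat_div ha n).symm
    rw [← sub_eq_zero, ← Finset.sum_sub_distrib] at h1
    rw [Pi.zero_apply, ← h1, Matrix.mulVec, dotProduct]
    refine Finset.sum_congr rfl fun k _ => ?_
    have := h.ghat_ne k
    have := h.denom_right_ne k
    have := h.sub_ne k n
    simp only [hv, M, Matrix.of_apply]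
    field_simp
  have hv0 := Matrix.eq_zero_of_mulVec_eq_zero (h.isUnit_det_M ha).ne_zero hMv
  ext k
  have h2 := congrFun hv0 k
  simp only [hv, Pi.zero_apply, div_eq_zero_iff, mul_eq_zero, h.denom_right_ne k, h.ghat_ne k,
    or_self, or_false, sub_eq_zero] at h2
  exact h2

theorem denom_matrix_mul_V0 (h : p.Regular x y) :
    (p.η • Matrix.diagonal x + p.β • (1 : Matrix (Fin N) (Fin N) ℂ)) * p.V0 x y
      = p.M x y * Matrix.diagonal y * (p.M x y)⁻¹ - p.α • Matrix.diagonal x := by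
  have : p.η • Matrix.diagonal x + p.β • (1 : Matrix (Fin N) (Fin N) ℂ)
      = Matrix.diagonal fun n => p.η * x n + p.β := by
    ext i j
    by_cases hij : i = j <;> simp [hij]
  rw [V0, this, Matrix.mul_nonsing_inv_cancel_left]
  rw [Matrix.det_diagonal]
  exact (Finset.prod_ne_zero_iff.mpr fun j _ => h.denom_ne j).isUnit

theorem V0_apply (ha : p.a ≠ 0) (h : p.Regular x y) (n m : Fin N) :
    p.V0 x y n m =
      -(p.α * x n / (p.η * x n + p.β)) * (if n = m then 1 else 0)
        + p.a ^ (1 - (N : ℤ)) / (p.η * x n + p.β)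
          * ∑ k, y k
            * (∏ j ∈ Finset.univ.erase k, (y j - p.a * x m - p.b) / (y j - y k))
            * ((∏ j ∈ Finset.univ.erase n, (y k - p.a * x j - p.b))
              / ∏ j ∈ Finset.univ.erase m, (x m - x j)) := by
  have hd := h.denom_ne n
  have hV := congrFun (congrFun h.denom_matrix_mul_V0 n) m
  rw [add_mul, Matrix.smul_mul, Matrix.smul_mul, Matrix.one_mul, h.inv_M ha] at hV
  simp only [Matrix.add_apply, Matrix.smul_apply, Matrix.diagonal_mul, smul_eq_mul,
    Matrix.sub_apply, Matrix.mul_apply (M := p.M x y * Matrix.diagonal y), Matrix.mul_diagonal,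
    Matrix.diagonal_apply] at hV
  have hterm : ∀ k, p.M x y n k * y k * p.MInv x y k m = p.a ^ (1 - (N : ℤ)) * (y k
            * (∏ j ∈ Finset.univ.erase k, (y j - p.a * x m - p.b) / (y j - y k))
            * ((∏ j ∈ Finset.univ.erase n, (y k - p.a * x j - p.b))
              / ∏ j ∈ Finset.univ.erase m, (x m - x j))) := by
    intro k
    have hg := h.ghat_ne k
    have hs := h.sub_ne k n
    have e1 : (y k - p.a * x m - p.b) * ∏ j ∈ Finset.univ.erase m, (y k - p.a * x j - p.b)
        = (y k - p.a * x n - p.b) * ∏ j ∈ Finset.univ.erase n, (y k - p.a * x j - p.b) := by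
      rw [Finset.mul_prod_erase Finset.univ (fun j => y k - p.a * x j - p.b) (Finset.mem_univ m),
        Finset.mul_prod_erase Finset.univ (fun j => y k - p.a * x j - p.b) (Finset.mem_univ n)]
    have hx : ∏ j ∈ Finset.univ.erase m, (x m - x j) ≠ 0 := Finset.prod_ne_zero_iff.mpr
      fun j hj => sub_ne_zero.mpr fun e => (Finset.mem_erase.mp hj).1 (h.inj_left e).symm
    simp only [M, MInv, Matrix.of_apply,
      Finset.prod_div_distrib (f := fun j => y k - p.a * x j - p.b)]
    field_simp
    linear_combination
      y k * (∏ j ∈ Finset.univ.erase k, (y j - p.a * x m - p.b) / (y j - y k)) * e1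
  rw [Finset.sum_congr rfl fun k _ => hterm k, ← Finset.mul_sum] at hV
  have hV' : (p.η * x n + p.β) * p.V0 x y n m = _ := (by ring : _ = _).trans hV
  rw [← mul_right_inj' hd, hV']
  generalize (∑ k : Fin N, _ : ℂ) = S
  generalize p.η * x n + p.β = D at hd ⊢
  split_ifs
  · field_simp
    ring
  · field_simp
    ring

end Regular

end Params

end DiscreteGoldfish
-- The matrix recursion and its explicit solution.
namespace DiscreteGoldfish

namespace Params

variable {N : ℕ} {p : Params} {x y : Fin N → ℂ}

theorem P_self (s : ℕ) : p.P x y s s = 1 := by simp [P]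

theorem P_succ {s t : ℕ} (h : s ≤ t) : p.P x y s (t + 1)
    = p.P x y s t * (p.γ ^ t • p.A x y + p.a • (1 : Matrix (Fin N) (Fin N) ℂ)) := by
  rw [P, P, Nat.sub_add_comm h, List.range'_concat, List.map_append, List.prod_append]
  simp [Nat.add_sub_cancel' h]

theorem U_zero : p.U x y 0 = Matrix.diagonal x := by simp [U, P_self]

theorem U_succ (ℓ : ℕ) : p.U x y (ℓ + 1)
    = p.U x y ℓ * (p.γ ^ ℓ • p.A x y + p.a • (1 : Matrix (Fin N) (Fin N) ℂ))
      + (p.γ ^ ℓ • p.B x y + p.b • (1 : Matrix (Fin N) (Fin N) ℂ)) := by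
  rw [U, Finset.sum_Icc_succ_top (by omega), P_self, Matrix.mul_one, Nat.add_sub_cancel,
    ← add_assoc, P_succ (Nat.zero_le ℓ), U, add_mul, Finset.sum_mul, Matrix.mul_assoc]
  congr 2
  refine Finset.sum_congr rfl fun k hk => ?_
  rw [P_succ (Finset.mem_Icc.mp hk).2, Matrix.mul_assoc]

/-- `A` and `B` are `η` and `β` times the same matrix `V0 - b / β`, so time enters only through the
scalar `γ ^ ℓ`. -/
theorem U_succ_eq (hβ : p.β ≠ 0) (ℓ : ℕ) : p.U x y (ℓ + 1)
    = p.a • p.U x y ℓ + p.b • (1 : Matrix (Fin N) (Fin N) ℂ)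
      + p.γ ^ ℓ • ((p.η • p.U x y ℓ + p.β • (1 : Matrix (Fin N) (Fin N) ℂ))
        * (p.V0 x y - (p.b / p.β) • (1 : Matrix (Fin N) (Fin N) ℂ))) := by
  rw [U_succ, A, B]
  simp only [mul_add, add_mul, mul_sub, smul_sub, smul_add, smul_smul, Matrix.smul_mul,
    Matrix.mul_smul, Matrix.mul_one, Matrix.one_mul]
  match_scalars <;> field_simp <;> ring

theorem matrix_system_solution (hγ₁ : p.γ ≠ 1) (hβ : p.β ≠ 0)
    {Us Vs : ℕ → Matrix (Fin N) (Fin N) ℂ}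
    (hU0 : Us 0 = Matrix.diagonal x) (hV0 : Vs 0 = p.V0 x y)
    (hU : ∀ ℓ, Us (ℓ + 1) = p.α • Us ℓ + p.β • Vs ℓ + p.η • (Us ℓ * Vs ℓ))
    (hV : ∀ ℓ, Vs (ℓ + 1) = p.ρ • (1 : Matrix (Fin N) (Fin N) ℂ) + p.γ • Vs ℓ) (ℓ : ℕ) :
    Us ℓ = p.U x y ℓ ∧ Vs ℓ = p.γ ^ ℓ • p.V0 x y
      + (p.ρ * ((p.γ ^ ℓ - 1) / (p.γ - 1))) • (1 : Matrix (Fin N) (Fin N) ℂ) := by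
  have h1 : p.γ - 1 ≠ 0 := sub_ne_zero.mpr hγ₁
  have h2 : 1 - p.γ ≠ 0 := sub_ne_zero.mpr hγ₁.symm
  induction ℓ with
  | zero => simp [hU0, hV0, U_zero]
  | succ ℓ ih =>
    obtain ⟨ihU, ihV⟩ := ih
    have hc : (p.γ ^ ℓ - 1) / (p.γ - 1) = (1 - p.γ ^ ℓ) / (1 - p.γ) := by
      rw [← neg_sub 1, ← neg_sub 1 p.γ, neg_div_neg_eq]
    constructor
    · rw [hU, ihU, ihV, U_succ, A, B, hc, a, b]
      simp only [mul_add, smul_add, smul_sub, smul_smul, mul_sub, Matrix.mul_smul, Matrix.mul_one]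
      match_scalars <;> field_simp <;> ring
    · rw [hV, ihV]
      match_scalars <;> field_simp <;> ring

/-! ### Propagation of eigenbases and the equations of motion. -/

/-- `z` and `w` are the spectra of `U`, `U'`, and in an eigenbasis of `U` the matrix `M z w`
diagonalizes `U'`. -/
def Diagonalizes (p : Params) (U U' : Matrix (Fin N) (Fin N) ℂ) (z w : Fin N → ℂ) : Prop :=
  ∃ R : Matrix (Fin N) (Fin N) ℂ, IsUnit R.det ∧ U * R = R * Matrix.diagonal z ∧
    U' * (R * p.M z w) = R * p.M z w * Matrix.diagonal w

/-- The matrix of `U(ℓ + 2)` in the eigenbasis of `U(ℓ + 1)`. -/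
noncomputable def stepMatrix (p : Params) (z w : Fin N → ℂ) : Matrix (Fin N) (Fin N) ℂ :=
  (Matrix.diagonal fun k => p.a * w k + p.b) + Matrix.of fun _ m => p.γ * p.ghat z w m

theorem charpoly_stepMatrix (z w : Fin N → ℂ) :
    (p.stepMatrix z w).charpoly = p.motionPoly z w := by
  rw [stepMatrix, charpoly_diagonal_add_row, motionPoly, Finset.mul_sum]
  simp only [map_mul, mul_assoc]

/-- `V0` is chosen precisely so that `U(1) = M diag y M⁻¹`. -/
theorem diagonalizes_initial (hβ : p.β ≠ 0) (ha : p.a ≠ 0) (h : p.Regular x y) :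
    p.Diagonalizes (p.U x y 0) (p.U x y 1) x y := by
  refine ⟨1, by simp, by simp [U_zero], ?_⟩
  have hU : p.U x y 1 = p.M x y * Matrix.diagonal y * (p.M x y)⁻¹ := by
    have hV := h.denom_matrix_mul_V0
    have hα : p.a - p.η / p.β * p.b = p.α := by
      rw [a, b]
      field_simp
      ring
    rw [← eq_sub_iff_add_eq.mp hV, U_succ, U_zero, A, B, ← hα]
    simp only [pow_zero, one_smul, mul_add, add_mul, mul_sub, sub_smul, Matrix.smul_mul,
      Matrix.mul_smul, Matrix.mul_one, Matrix.one_mul]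
    match_scalars <;> ring
  rw [hU, Matrix.one_mul, Matrix.mul_assoc _ _ (p.M x y),
    Matrix.nonsing_inv_mul _ (h.isUnit_det_M ha), Matrix.mul_one]

theorem smul_add_smul_one_mul {U R : Matrix (Fin N) (Fin N) ℂ} {z : Fin N → ℂ}
    (h : U * R = R * Matrix.diagonal z) (s t : ℂ) :
    (s • U + t • (1 : Matrix (Fin N) (Fin N) ℂ)) * R
      = R * Matrix.diagonal fun k => s * z k + t := by
  have : (Matrix.diagonal fun k => s * z k + t)
      = s • Matrix.diagonal z + t • (1 : Matrix (Fin N) (Fin N) ℂ) := by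
    ext i j
    by_cases hij : i = j <;> simp [hij]
  rw [this, add_mul, mul_add, Matrix.smul_mul, Matrix.smul_mul, Matrix.mul_smul, Matrix.mul_smul,
    h, Matrix.one_mul, Matrix.mul_one]

/-- The evolution `U(ℓ + 1) = a U(ℓ) + b + γ ^ ℓ (η U(ℓ) + β) W`, in the eigenbasis of
`U(ℓ + 1)`. -/
theorem step_mul {U U' U'' W R : Matrix (Fin N) (Fin N) ℂ} {z w : Fin N → ℂ} (ha : p.a ≠ 0)
    (h : p.Regular z w) (hR : IsUnit R.det) (c : ℂ)
    (hU : U * R = R * Matrix.diagonal z)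
    (hU' : U' * (R * p.M z w) = R * p.M z w * Matrix.diagonal w)
    (e1 : U' = p.a • U + p.b • (1 : Matrix (Fin N) (Fin N) ℂ)
      + c • ((p.η • U + p.β • (1 : Matrix (Fin N) (Fin N) ℂ)) * W))
    (e2 : U'' = p.a • U' + p.b • (1 : Matrix (Fin N) (Fin N) ℂ)
      + (p.γ * c) • ((p.η • U' + p.β • (1 : Matrix (Fin N) (Fin N) ℂ)) * W)) :
    U'' * (R * p.M z w) = R * p.M z w * p.stepMatrix z w := by
  set M := p.M z w with hM
  set D : Matrix (Fin N) (Fin N) ℂ := Matrix.diagonal fun n => p.η * z n + p.β with hD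
  set E : Matrix (Fin N) (Fin N) ℂ := Matrix.diagonal fun n => p.η * w n + p.β with hE
  set G : Matrix (Fin N) (Fin N) ℂ := Matrix.of fun _ m => p.ghat z w m with hG
  set W' : Matrix (Fin N) (Fin N) ℂ := R⁻¹ * W * R with hW'
  have hDu : IsUnit D.det := by
    rw [hD, Matrix.det_diagonal]
    exact (Finset.prod_ne_zero_iff.mpr fun j _ => h.denom_ne j).isUnit
  have hEu : IsUnit E.det := by
    rw [hE, Matrix.det_diagonal]
    exact (Finset.prod_ne_zero_iff.mpr fun j _ => h.denom_right_ne j).isUnit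
  have hWR : W * R = R * W' := by
    rw [hW', Matrix.mul_assoc, Matrix.mul_nonsing_inv_cancel_left _ _ hR]
  have hGM : M * Matrix.diagonal w - (Matrix.diagonal fun n => p.a * z n + p.b) * M = G := by
    ext n m
    have := h.sub_ne m n
    simp only [hM, hG, Params.M, Matrix.sub_apply, Matrix.mul_diagonal, Matrix.diagonal_mul,
      Matrix.of_apply]
    field_simp
    ring
  -- Entrywise this is the linear system for `ĝ`, multiplied by `ĝ_m (η z_n + β)`.
  have hDMG : D * (M * (E⁻¹ * G)) = G := by
    have hEG : E⁻¹ * G = Matrix.of fun k m => p.ghat z w m / (p.η * w k + p.β) := by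
      rw [← Matrix.nonsing_inv_mul_cancel_left E (Matrix.of fun k m => _) hEu]
      congr 1
      ext k m
      have := h.denom_right_ne k
      simp only [hG, hE, Matrix.diagonal_mul, Matrix.of_apply]
      field_simp
    rw [hEG]
    ext n m
    have hs := h.sum_ghat_div ha n
    have hd := h.denom_ne n
    rw [eq_div_iff hd] at hs
    rw [hD, Matrix.diagonal_mul, Matrix.mul_apply]
    simp only [hG, hM, Params.M, Matrix.of_apply]
    calc _ = p.ghat z w m * ((∑ k, p.ghat z w k / ((p.η * w k + p.β) * (w k - p.a * z n - p.b)))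
            * (p.η * z n + p.β)) := by
          rw [Finset.mul_sum, Finset.sum_mul, Finset.mul_sum]
          refine Finset.sum_congr rfl fun k _ => ?_
          have := h.denom_right_ne k
          have := h.sub_ne k n
          field_simp
      _ = _ := by rw [hs, mul_one]
  -- Reading `e1` in the basis `R` gives `D (c W' M) = G`; comparison with `hDMG` cancels `D`.
  have hW'M : c • (W' * M) = M * (E⁻¹ * G) := by
    have h1 : R * (D * (c • (W' * M))) = R * G := by
      have h2 : c • ((p.η • U + p.β • (1 : Matrix (Fin N) (Fin N) ℂ)) * W) * (R * M)
          = U' * (R * M) - (p.a • U + p.b • (1 : Matrix (Fin N) (Fin N) ℂ)) * R * M := by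
        rw [e1, add_mul _ _ (R * M), Matrix.mul_assoc _ R M, add_sub_cancel_left]
      rw [hU', smul_add_smul_one_mul hU, Matrix.mul_assoc R, Matrix.mul_assoc R, ← mul_sub, hGM,
        Matrix.smul_mul, Matrix.mul_assoc, ← Matrix.mul_assoc W, hWR, Matrix.mul_assoc R,
        ← Matrix.mul_assoc _ R, smul_add_smul_one_mul hU, ← hD, Matrix.mul_assoc] at h2
      rw [← h2, Matrix.mul_smul, Matrix.mul_smul]
    have h3 := congrArg (fun X => D⁻¹ * (R⁻¹ * X)) h1
    simp only [Matrix.nonsing_inv_mul_cancel_left _ _ hR] at h3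
    rw [Matrix.nonsing_inv_mul_cancel_left _ _ hDu] at h3
    rw [h3]
    nth_rewrite 1 [← hDMG]
    rw [Matrix.nonsing_inv_mul_cancel_left _ _ hDu]
  have h4 : (p.γ * c) • ((p.η • U' + p.β • (1 : Matrix (Fin N) (Fin N) ℂ)) * W) * (R * M)
      = p.γ • (R * M * G) := by
    rw [Matrix.smul_mul, Matrix.mul_assoc, ← Matrix.mul_assoc W, hWR, Matrix.mul_assoc R,
      ← smul_smul, ← Matrix.mul_smul _ c, ← Matrix.mul_smul _ c, hW'M, ← Matrix.mul_assoc R,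
      ← Matrix.mul_assoc _ (R * M), smul_add_smul_one_mul hU', ← hE, Matrix.mul_assoc (R * M) E,
      Matrix.mul_nonsing_inv_cancel_left _ _ hEu]
  have hS : p.stepMatrix z w = (Matrix.diagonal fun k => p.a * w k + p.b) + p.γ • G := rfl
  rw [e2, add_mul _ _ (R * M), h4, smul_add_smul_one_mul hU', hS, mul_add, Matrix.mul_smul]

/-- Column `m` of `M(w,v)` is a multiple of `1 / (v m - a w n - b)`, and the eigenvector equation
for it is the equation of motion at `ζ = v m`. -/
theorem stepMatrix_mul_M (hγ : p.γ ≠ 0) (ha : p.a ≠ 0) {z w v : Fin N → ℂ} (h : p.Regular z w)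
    (h' : p.Regular w v) (hup : p.IsUpdate z w v) :
    p.stepMatrix z w * p.M w v = p.M w v * Matrix.diagonal v := by
  ext n m
  have hroot : (p.motionPoly z w).eval (v m) = 0 := by
    have : v m ∈ (p.motionPoly z w).roots := by
      rw [hup]; exact Multiset.mem_map_of_mem v (Finset.mem_univ m)
    exact Polynomial.isRoot_of_mem_roots this
  have hs := ((p.eval_motionPoly_eq_zero_iff hγ ha h (v m)).mp hroot).2
  rw [eq_div_iff hγ] at hs
  have hne := h'.sub_ne m n
  rw [stepMatrix, add_mul, Matrix.add_apply, Matrix.diagonal_mul, Matrix.mul_diagonal,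
    Matrix.mul_apply]
  simp only [M, Matrix.of_apply]
  have : ∑ k, p.γ * p.ghat z w k * (p.ghat w v m / (v m - p.a * w k - p.b)) = p.ghat w v m := by
    calc _ = p.ghat w v m * ((∑ k, p.ghat z w k / (v m - p.a * w k - p.b)) * p.γ) := by
          rw [Finset.sum_mul, Finset.mul_sum]
          exact Finset.sum_congr rfl fun k _ => by ring
      _ = _ := by rw [hs, mul_one]
  rw [this]
  field_simp
  ring

/-- Nothing is required of the next configuration, so this reaches the final time `L`, where
regularity is not assumed, and serves both directions of the equivalence. -/
theorem Diagonalizes.charpoly_step (hβ : p.β ≠ 0) (ha : p.a ≠ 0) {z w : Fin N → ℂ}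
    (h : p.Regular z w) {ℓ : ℕ} (hd : p.Diagonalizes (p.U x y ℓ) (p.U x y (ℓ + 1)) z w) :
    (p.U x y (ℓ + 2)).charpoly = p.motionPoly z w := by
  obtain ⟨R, hR, hU, hU'⟩ := hd
  rw [← charpoly_stepMatrix]
  refine charpoly_eq_of_mul_eq_mul (R := R * p.M z w) ?_
    (step_mul ha h hR (p.γ ^ ℓ) hU hU' (U_succ_eq hβ ℓ) ?_)
  · rw [Matrix.det_mul]
    exact hR.mul (h.isUnit_det_M ha)
  · rw [← pow_succ']
    exact U_succ_eq hβ (ℓ + 1)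

theorem Diagonalizes.succ (hβ : p.β ≠ 0) (hγ : p.γ ≠ 0) (ha : p.a ≠ 0) {z w v : Fin N → ℂ}
    (h : p.Regular z w) (h' : p.Regular w v) (hup : p.IsUpdate z w v) {ℓ : ℕ}
    (hd : p.Diagonalizes (p.U x y ℓ) (p.U x y (ℓ + 1)) z w) :
    p.Diagonalizes (p.U x y (ℓ + 1)) (p.U x y (ℓ + 2)) w v := by
  obtain ⟨R, hR, hU, hU'⟩ := hd
  refine ⟨R * p.M z w, ?_, hU', ?_⟩
  · rw [Matrix.det_mul]
    exact hR.mul (h.isUnit_det_M ha)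
  · rw [← Matrix.mul_assoc, step_mul ha h hR (p.γ ^ ℓ) hU hU' (U_succ_eq hβ ℓ)
        ((pow_succ' p.γ ℓ) ▸ U_succ_eq hβ (ℓ + 1)),
      Matrix.mul_assoc, stepMatrix_mul_M hγ ha h h' hup, Matrix.mul_assoc, Matrix.mul_assoc,
      Matrix.mul_assoc]

theorem charpoly_roots_of_mul_eq_mul_diagonal {R T : Matrix (Fin N) (Fin N) ℂ} {z : Fin N → ℂ}
    (hR : IsUnit R.det) (h : T * R = R * Matrix.diagonal z) :
    T.charpoly.roots = (Finset.univ : Finset (Fin N)).val.map z := by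
  rw [charpoly_eq_of_mul_eq_mul hR h, Matrix.charpoly_diagonal,
    ← Polynomial.roots_multiset_prod_X_sub_C (Finset.univ.val.map z), Multiset.map_map]
  rfl

theorem isUpdate_iff_charpoly_roots (hβ : p.β ≠ 0) (hγ : p.γ ≠ 0) (ha : p.a ≠ 0)
    (z : ℕ → Fin N → ℂ) (L : ℕ) (hinit : p.Regular (z 0) (z 1))
    (hreg : ∀ ℓ, ℓ + 2 ≤ L → p.Regular (z ℓ) (z (ℓ + 1))) :
    (∀ ℓ, ℓ + 2 ≤ L → p.IsUpdate (z ℓ) (z (ℓ + 1)) (z (ℓ + 2))) ↔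
      ∀ ℓ ≤ L, (p.U (z 0) (z 1) ℓ).charpoly.roots
        = (Finset.univ : Finset (Fin N)).val.map (z ℓ) := by
  have h0 := diagonalizes_initial hβ ha hinit
  have hdiag : ∀ ℓ, ℓ + 2 ≤ L →
      (∀ k < ℓ, p.IsUpdate (z k) (z (k + 1)) (z (k + 2))) →
      p.Diagonalizes (p.U (z 0) (z 1) ℓ) (p.U (z 0) (z 1) (ℓ + 1)) (z ℓ) (z (ℓ + 1)) := by
    intro ℓ
    induction ℓ with
    | zero => exact fun _ _ => h0
    | succ ℓ ih =>
      intro hL hup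
      exact (ih (by omega) fun k hk => hup k (by omega)).succ hβ hγ ha (hreg ℓ (by omega))
        (hreg (ℓ + 1) hL) (hup ℓ (by omega))
  constructor
  · intro hup ℓ hℓ
    match ℓ, hℓ with
    | 0, _ =>
      obtain ⟨R, hR, hU, -⟩ := h0
      exact charpoly_roots_of_mul_eq_mul_diagonal hR hU
    | 1, _ =>
      obtain ⟨R, hR, -, hU⟩ := h0
      refine charpoly_roots_of_mul_eq_mul_diagonal (R := R * p.M (z 0) (z 1)) ?_ hU
      rw [Matrix.det_mul]
      exact hR.mul (hinit.isUnit_det_M ha)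
    | ℓ + 2, hℓ =>
      rw [(hdiag ℓ hℓ fun k hk => hup k (by omega)).charpoly_step hβ ha (hreg ℓ hℓ)]
      exact hup ℓ hℓ
  · intro hroots ℓ
    -- The eigenbasis at time `ℓ` uses only the updates with index below `ℓ`, which the induction
    -- hypothesis supplies.
    induction ℓ using Nat.strong_induction_on with
    | _ ℓ ih =>
      intro hℓ
      rw [IsUpdate, ← (hdiag ℓ hℓ fun k hk => ih k hk (by omega)).charpoly_step hβ ha (hreg ℓ hℓ)]
      exact hroots (ℓ + 2) hℓ

end Params

end DiscreteGoldfish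

open DiscreteGoldfish in
theorem proposition2p4p1 {N : ℕ} (p : Params)
    (hβ : p.β ≠ 0) (hγ₀ : p.γ ≠ 0) (hγ₁ : p.γ ≠ 1) (ha : p.a ≠ 0)
    (z : ℕ → Fin N → ℂ) (L : ℕ) (hinit : p.Regular (z 0) (z 1))
    (hreg : ∀ ℓ, ℓ + 2 ≤ L → p.Regular (z ℓ) (z (ℓ + 1))) :
    -- the equations of motion hold if and only if the coordinates are the eigenvalues of `U(ℓ)`
    ((∀ ℓ, ℓ + 2 ≤ L → p.IsUpdate (z ℓ) (z (ℓ + 1)) (z (ℓ + 2))) ↔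
      ∀ ℓ ≤ L, (p.U (z 0) (z 1) ℓ).charpoly.roots
        = (Finset.univ : Finset (Fin N)).val.map (z ℓ)) ∧
    -- `U(ℓ)` solves the initial-value problem of the matrix system
    (∀ Us Vs : ℕ → Matrix (Fin N) (Fin N) ℂ,
      Us 0 = Matrix.diagonal (z 0) → Vs 0 = p.V0 (z 0) (z 1) →
      (∀ ℓ, Us (ℓ + 1) = p.α • Us ℓ + p.β • Vs ℓ + p.η • (Us ℓ * Vs ℓ)) →
      (∀ ℓ, Vs (ℓ + 1) = p.ρ • (1 : Matrix (Fin N) (Fin N) ℂ) + p.γ • Vs ℓ) →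
      ∀ ℓ, Us ℓ = p.U (z 0) (z 1) ℓ ∧
        Vs ℓ = p.γ ^ ℓ • p.V0 (z 0) (z 1)
          + (p.ρ * ((p.γ ^ ℓ - 1) / (p.γ - 1))) • (1 : Matrix (Fin N) (Fin N) ℂ)) ∧
    -- `ĝ` is the unique solution of the associated linear system
    (∀ g : Fin N → ℂ,
      (∀ n, ∑ k, g k / ((p.η * z 1 k + p.β) * (z 1 k - p.a * z 0 n - p.b))
          = 1 / (p.η * z 0 n + p.β)) ↔
        g = p.ghat (z 0) (z 1)) ∧
    -- the inverse of `M(0)`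
    IsUnit (p.M (z 0) (z 1)).det ∧
    (∀ n m, (p.M (z 0) (z 1))⁻¹ n m =
      p.a ^ (1 - (N : ℤ)) * ((z 1 n - p.a * z 0 m - p.b) / p.ghat (z 0) (z 1) n)
        * (∏ j ∈ Finset.univ.erase n, (z 1 j - p.a * z 0 m - p.b) / (z 1 j - z 1 n))
        * ∏ j ∈ Finset.univ.erase m, (z 1 n - p.a * z 0 j - p.b) / (z 0 m - z 0 j)) ∧
    -- the components of `V(0)`
    (∀ n m, p.V0 (z 0) (z 1) n m =
      -(p.α * z 0 n / (p.η * z 0 n + p.β)) * (if n = m then 1 else 0)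
        + p.a ^ (1 - (N : ℤ)) / (p.η * z 0 n + p.β)
          * ∑ k, z 1 k
            * (∏ j ∈ Finset.univ.erase k, (z 1 j - p.a * z 0 m - p.b) / (z 1 j - z 1 k))
            * ((∏ j ∈ Finset.univ.erase n, (z 1 k - p.a * z 0 j - p.b))
              / ∏ j ∈ Finset.univ.erase m, (z 0 m - z 0 j))) := by

  exact ⟨Params.isUpdate_iff_charpoly_roots hβ hγ₀ ha z L hinit hreg,
    fun _ _ hU0 hV0 hU hV => Params.matrix_system_solution hγ₁ hβ hU0 hV0 hU hV,
    hinit.linear_system_iff ha, hinit.isUnit_det_M ha,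
    fun n m => by rw [hinit.inv_M ha]; rfl,
    hinit.V0_apply ha⟩
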